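/- Let $L_2$ be the two-sorted language of second-order arithmetic, with number variables, set variables, the symbols $0,1,+,\cdot,\le$ and equality on numbers, and membership $\in$ of numbers in sets. A formula is $\Delta^0_0$ if all its quantifiers are bounded number quantifiers ($\forall x\le t$, $\exists x\le t$), $\Sigma^0_1$ if it is of the form $\exists\bar x\,\theta$ and $\Sigma^0_2$ if it is of the form $\exists\bar x\,\forall\bar y\,\theta$, with $\theta$ a $\Delta^0_0$ formula and $\bar x,\bar y$ blocks of number variables; free number and set variables are allowed as parameters. For $k=1,2$, $\Sigma^0_k$-$\mathsf{IND}$ is the scheme of all sentences $$\forall \bar Y\,\forall\bar y\,\big[\varphi(0)\land\forall x\,(\varphi(x)\Rightarrow\varphi(x+1))\Rightarrow\forall x\,\varphi(x)\big],\qquad \varphi(x)=\varphi(x,\bar Y,\bar y)\ \text{a } \Sigma^0_k \text{ formula}.$$ The theory $\mathsf{RCA}_0$ consists of the axioms saying that the numbers form the non-negative part of a discretely ordered ring, the scheme $\Sigma^0_1$-$\mathsf{IND}$, and $\Delta^0_1$-comprehension $$\forall \bar Y\,\forall\bar y\,\big[\forall x\,(\varphi(x)\Leftrightarrow\neg\psi(x))\Rightarrow\exists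 X\,\forall x\,(x\in X\Leftrightarrow\varphi(x))\big],\qquad \varphi(x)=\varphi(x,\bar Y,\bar y),\ \psi(x)=\psi(x,\bar Y,\bar y)\ \text{$\Sigma^0_1$ formulas}.$$ Ordered Ramsey's Theorem is the $L_2$-sentence stating: for every finite partial order $(P,\preceq)$ and every colouring $C:[\mathbb N]^2\to P$ such that $C(i,j)\succeq C(i,k)$ for all $i<j<k$, there is an infinite set $I\subseteq\mathbb N$ such that $C(i,j)=C(i',j')$ for all $i<j$ and $i'<j'$ in $I$. (Here finite means bounded, infinite means unbounded, and the relation $\preceq$ and the function $C$ are coded as sets of numbers through the pairing $\langle i,j\rangle=(i+j)^2+i$.) Over $\mathsf{RCA}_0$, Ordered Ramsey's Theorem implies $\Sigma^0_2$-$\mathsf{IND}$; that is, every sentence of $\Sigma^0_2$-$\mathsf{IND}$ is a logical consequence of $\mathsf{RCA}_0$ together with Ordered Ramsey's Theorem: it holds in every $L_2$-structure that is a model of $\mathsf{RCA}_0$ and of Ordered Ramsey's Theorem. -/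

import Mathlib

universe u

namespace SecondOrderArithmetic

/-! ### Syntax of the two-sorted language `L₂`

Variables are de Bruijn indices: a formula in `Formula m n` has its free set variables in `Fin m`
and its free number variables in `Fin n`; a quantifier binds the variable of index `0`. -/

/-- Number terms with free variables in `Fin n`. -/
inductive Term (n : ℕ) : Type
  | var (i : Fin n) : Term n
  | zero : Term n
  | one : Term n
  | add (s t : Term n) : Term n
  | mul (s t : Term n) : Term n

instance (n : ℕ) : Zero (Term n) := ⟨Term.zero⟩

instance (n : ℕ) : One (Term n) := ⟨Term.one⟩

instance (n : ℕ) : Add (Term n) := ⟨Term.add⟩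

instance (n : ℕ) : Mul (Term n) := ⟨Term.mul⟩

/-- Formulas of `L₂` with free set variables in `Fin m` and free number variables in `Fin n`. -/
inductive Formula : ℕ → ℕ → Type
  | eq {m n : ℕ} (s t : Term n) : Formula m n
  | le {m n : ℕ} (s t : Term n) : Formula m n
  | mem {m n : ℕ} (t : Term n) (X : Fin m) : Formula m n
  | not {m n : ℕ} (φ : Formula m n) : Formula m n
  | and {m n : ℕ} (φ ψ : Formula m n) : Formula m n
  | or {m n : ℕ} (φ ψ : Formula m n) : Formula m n
  | imp {m n : ℕ} (φ ψ : Formula m n) : Formula m n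
  | all {m n : ℕ} (φ : Formula m (n + 1)) : Formula m n
  | ex {m n : ℕ} (φ : Formula m (n + 1)) : Formula m n
  | allSet {m n : ℕ} (φ : Formula (m + 1) n) : Formula m n
  | exSet {m n : ℕ} (φ : Formula (m + 1) n) : Formula m n

/-- Sentences of `L₂`. -/
abbrev Sentence : Type := Formula 0 0

local prefix:max "♯" => Term.var
local infix:60 " ≐ " => Formula.eq
local infix:60 " ≼ " => Formula.le
local infix:60 " ε " => Formula.mem
local infixr:50 " ⋏ " => Formula.and
local infixr:40 " ⟹ " => Formula.imp

/-- Simultaneous substitution of number terms for number variables. -/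
def Term.subst {n n' : ℕ} (σ : Fin n → Term n') : Term n → Term n'
  | .var i => σ i
  | .zero => .zero
  | .one => .one
  | .add s t => .add (s.subst σ) (t.subst σ)
  | .mul s t => .mul (s.subst σ) (t.subst σ)

/-- Weakening by one fresh number variable, of index `0`. -/
def Term.lift {n : ℕ} (t : Term n) : Term (n + 1) := t.subst fun i => ♯i.succ

/-- Simultaneous capture-avoiding substitution of terms for number variables and renaming of set
variables. -/
def Formula.subst {m n : ℕ} : Formula m n → {m' n' : ℕ} → (Fin m → Fin m') → (Fin n → Term n') →
    Formula m' n'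
  | .eq s t, _, _, _, σ => .eq (s.subst σ) (t.subst σ)
  | .le s t, _, _, _, σ => .le (s.subst σ) (t.subst σ)
  | .mem t X, _, _, ρ, σ => .mem (t.subst σ) (ρ X)
  | .not φ, _, _, ρ, σ => .not (φ.subst ρ σ)
  | .and φ ψ, _, _, ρ, σ => .and (φ.subst ρ σ) (ψ.subst ρ σ)
  | .or φ ψ, _, _, ρ, σ => .or (φ.subst ρ σ) (ψ.subst ρ σ)
  | .imp φ ψ, _, _, ρ, σ => .imp (φ.subst ρ σ) (ψ.subst ρ σ)
  | .all φ, _, _, ρ, σ => .all (φ.subst ρ (Matrix.vecCons ♯0 fun i => (σ i).lift))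
  | .ex φ, _, _, ρ, σ => .ex (φ.subst ρ (Matrix.vecCons ♯0 fun i => (σ i).lift))
  | .allSet φ, _, _, ρ, σ => .allSet (φ.subst (Matrix.vecCons 0 fun i => (ρ i).succ) σ)
  | .exSet φ, _, _, ρ, σ => .exSet (φ.subst (Matrix.vecCons 0 fun i => (ρ i).succ) σ)

namespace Formula

/-- `s < t`. -/
def lt {m n : ℕ} (s t : Term n) : Formula m n := s ≼ t ⋏ not (s ≐ t)

/-- `φ ⇔ ψ`. -/
def iff {m n : ℕ} (φ ψ : Formula m n) : Formula m n := (φ ⟹ ψ) ⋏ (ψ ⟹ φ)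

/-- A block of `k` existential number quantifiers. -/
def exBlock {m n : ℕ} : (k : ℕ) → Formula m (n + k) → Formula m n
  | 0, φ => φ
  | k + 1, φ => exBlock k (ex φ)

/-- A block of `k` universal number quantifiers. -/
def allBlock {m n : ℕ} : (k : ℕ) → Formula m (n + k) → Formula m n
  | 0, φ => φ
  | k + 1, φ => allBlock k (all φ)

/-- Universal closure with respect to all number variables. -/
def closeNum {m : ℕ} : {n : ℕ} → Formula m n → Formula m 0
  | 0, φ => φ
  | _ + 1, φ => closeNum (all φ)

/-- Universal closure with respect to all set variables. -/
def closeSet : {m : ℕ} → Formula m 0 → Sentence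
  | 0, φ => φ
  | _ + 1, φ => closeSet (allSet φ)

/-- Universal closure. -/
def close {m n : ℕ} (φ : Formula m n) : Sentence := closeSet (closeNum φ)

/-- `Δ⁰₀` formulas: all quantifiers are bounded number quantifiers `∀ x ≤ t` and `∃ x ≤ t`, where
the variable `x` does not occur in the term `t`. -/
inductive IsDelta0 : {m n : ℕ} → Formula m n → Prop
  | eq {m n : ℕ} (s t : Term n) : IsDelta0 (eq (m := m) s t)
  | le {m n : ℕ} (s t : Term n) : IsDelta0 (le (m := m) s t)
  | mem {m n : ℕ} (t : Term n) (X : Fin m) : IsDelta0 (mem t X)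
  | not {m n : ℕ} {φ : Formula m n} : IsDelta0 φ → IsDelta0 (not φ)
  | and {m n : ℕ} {φ ψ : Formula m n} : IsDelta0 φ → IsDelta0 ψ → IsDelta0 (and φ ψ)
  | or {m n : ℕ} {φ ψ : Formula m n} : IsDelta0 φ → IsDelta0 ψ → IsDelta0 (or φ ψ)
  | imp {m n : ℕ} {φ ψ : Formula m n} : IsDelta0 φ → IsDelta0 ψ → IsDelta0 (imp φ ψ)
  | ball {m n : ℕ} (t : Term n) {φ : Formula m (n + 1)} :
      IsDelta0 φ → IsDelta0 (all (♯0 ≼ t.lift ⟹ φ))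
  | bex {m n : ℕ} (t : Term n) {φ : Formula m (n + 1)} :
      IsDelta0 φ → IsDelta0 (ex (♯0 ≼ t.lift ⋏ φ))

/-- `QForm true k φ`: `φ` is `∃ x̄₁ ∀ x̄₂ … ψ` with `k` alternating blocks of number quantifiers,
the first existential, and `ψ` a `Δ⁰₀` formula; `QForm false k φ`: the same, starting with a
universal block. -/
def QForm : Bool → (k : ℕ) → {m n : ℕ} → Formula m n → Prop
  | _, 0, _, _, φ => IsDelta0 φ
  | true, k + 1, m, n, φ => ∃ (j : ℕ) (ψ : Formula m (n + j)), QForm false k ψ ∧ φ = exBlock j ψ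
  | false, k + 1, m, n, φ => ∃ (j : ℕ) (ψ : Formula m (n + j)), QForm true k ψ ∧ φ = allBlock j ψ

/-- `Σ⁰ₖ` formulas. -/
def IsSigma (k : ℕ) {m n : ℕ} (φ : Formula m n) : Prop := QForm true k φ

end Formula

open Formula

/-! ### Theories -/

/-- The axioms saying that the number sort is the non-negative part of a discretely ordered
(commutative) ring. -/
def basicAxioms : Set Sentence :=
  { close (m := 0) (n := 3) ((♯0 + ♯1) + ♯2 ≐ ♯0 + (♯1 + ♯2)),
    close (m := 0) (n := 2) (♯0 + ♯1 ≐ ♯1 + ♯0),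
    close (m := 0) (n := 1) (♯0 + 0 ≐ ♯0),
    close (m := 0) (n := 3) ((♯0 * ♯1) * ♯2 ≐ ♯0 * (♯1 * ♯2)),
    close (m := 0) (n := 2) (♯0 * ♯1 ≐ ♯1 * ♯0),
    close (m := 0) (n := 1) (♯0 * 1 ≐ ♯0),
    close (m := 0) (n := 1) (♯0 * 0 ≐ 0),
    close (m := 0) (n := 3) (♯0 * (♯1 + ♯2) ≐ ♯0 * ♯1 + ♯0 * ♯2),
    close (m := 0) (n := 1) (♯0 ≼ ♯0),
    close (m := 0) (n := 2) (♯0 ≼ ♯1 ⋏ ♯1 ≼ ♯0 ⟹ ♯0 ≐ ♯1),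
    close (m := 0) (n := 3) (♯0 ≼ ♯1 ⋏ ♯1 ≼ ♯2 ⟹ ♯0 ≼ ♯2),
    close (m := 0) (n := 2) (or (♯0 ≼ ♯1) (♯1 ≼ ♯0)),
    close (m := 0) (n := 3) (lt ♯0 ♯1 ⟹ lt (♯0 + ♯2) (♯1 + ♯2)),
    close (m := 0) (n := 3) (lt 0 ♯2 ⋏ lt ♯0 ♯1 ⟹ lt (♯0 * ♯2) (♯1 * ♯2)),
    close (m := 0) (n := 2) (♯0 ≼ ♯1 ⟹ ex (♯1 + ♯0 ≐ ♯2)),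
    close (m := 0) (n := 1) (0 ≼ ♯0),
    close (m := 0) (n := 0) (lt 0 1),
    close (m := 0) (n := 1) (lt 0 ♯0 ⟹ 1 ≼ ♯0) }

/-- The instance `∀ Ȳ ∀ ȳ [φ(0) ∧ ∀ x (φ(x) ⇒ φ(x + 1)) ⇒ ∀ x φ(x)]` of induction; the induction
variable has index `0` in `φ`. -/
def inductionAxiom {m n : ℕ} (φ : Formula m (n + 1)) : Sentence :=
  close ((φ.subst id (Matrix.vecCons 0 Term.var) ⋏
    all (φ ⟹ φ.subst id (Matrix.vecCons (♯0 + 1) fun i => ♯i.succ))) ⟹ all φ)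

/-- The scheme `Σ⁰ₖ-IND`. -/
def SigmaInduction (k : ℕ) : Set Sentence :=
  {χ | ∃ (m n : ℕ) (φ : Formula m (n + 1)), IsSigma k φ ∧ χ = inductionAxiom φ}

/-- The instance `∀ Ȳ ∀ ȳ [∀ x (φ(x) ⇔ ¬ψ(x)) ⇒ ∃ X ∀ x (x ∈ X ⇔ φ(x))]` of comprehension, where
`X` does not occur in `φ`. -/
def deltaComprehensionAxiom {m n : ℕ} (φ ψ : Formula m (n + 1)) : Sentence :=
  close (all (iff φ (not ψ)) ⟹ exSet (all (iff (♯0 ε 0) (φ.subst Fin.succ Term.var))))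

/-- The scheme of `Δ⁰₁`-comprehension. -/
def DeltaComprehension : Set Sentence :=
  {χ | ∃ (m n : ℕ) (φ ψ : Formula m (n + 1)), IsSigma 1 φ ∧ IsSigma 1 ψ ∧
    χ = deltaComprehensionAxiom φ ψ}

/-- The theory `RCA₀`. -/
def RCA0 : Set Sentence := basicAxioms ∪ DeltaComprehension ∪ SigmaInduction 1

/-! ### Ordered Ramsey's Theorem as a sentence of `L₂` -/

/-- The usual pairing `⟨s, t⟩ = (s + t)² + s` of second-order arithmetic. -/
def Term.pair {n : ℕ} (s t : Term n) : Term n := (s + t) * (s + t) + s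

/-- `P` is finite, that is, bounded. -/
def isFinite {m : ℕ} (P : Fin m) : Formula m 0 := ex (all (♯0 ε P ⟹ lt ♯0 ♯1))

/-- `R` is (the set of codes of pairs of) a partial order on the set `P`. -/
def isPartialOrder {m : ℕ} (P R : Fin m) : Formula m 0 :=
  closeNum (n := 1) (♯0 ε R ⟹ ex (ex (♯0 ε P ⋏ ♯1 ε P ⋏ ♯2 ≐ Term.pair ♯0 ♯1))) ⋏
  closeNum (n := 1) (♯0 ε P ⟹ Term.pair ♯0 ♯0 ε R) ⋏
  closeNum (n := 2) (Term.pair ♯0 ♯1 ε R ⋏ Term.pair ♯1 ♯0 ε R ⟹ ♯0 ≐ ♯1) ⋏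
  closeNum (n := 3) (Term.pair ♯0 ♯1 ε R ⋏ Term.pair ♯1 ♯2 ε R ⟹ Term.pair ♯0 ♯2 ε R)

/-- `C(i, j) = p`, for the colouring coded by the set `C` of codes `⟨⟨i, j⟩, p⟩`. -/
def hasColour {m n : ℕ} (C : Fin m) (i j p : Term n) : Formula m n :=
  Term.pair (Term.pair i j) p ε C

/-- `C` is a function from `[ℕ]²` to `P`; an unordered pair `{i, j}` with `i < j` is represented by
`⟨i, j⟩`. -/
def isColouring {m : ℕ} (P C : Fin m) : Formula m 0 :=
  closeNum (n := 1) (♯0 ε C ⟹ ex (ex (ex (lt ♯0 ♯1 ⋏ ♯2 ε P ⋏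
    ♯3 ≐ Term.pair (Term.pair ♯0 ♯1) ♯2)))) ⋏
  closeNum (n := 2) (lt ♯0 ♯1 ⟹ ex (hasColour C ♯1 ♯2 ♯0)) ⋏
  closeNum (n := 4) (hasColour C ♯0 ♯1 ♯2 ⋏ hasColour C ♯0 ♯1 ♯3 ⟹ ♯2 ≐ ♯3)

/-- `C(i, j) ⪰ C(i, k)` for all `i < j < k`. The variables `0, …, 4` are `i, j, k`, `C(i, j)`,
`C(i, k)`. -/
def isOrdered {m : ℕ} (R C : Fin m) : Formula m 0 :=
  closeNum (n := 5) (lt ♯0 ♯1 ⋏ lt ♯1 ♯2 ⋏ hasColour C ♯0 ♯1 ♯3 ⋏ hasColour C ♯0 ♯2 ♯4 ⟹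
    Term.pair ♯4 ♯3 ε R)

/-- `I` is infinite, that is, unbounded. -/
def isInfinite {m : ℕ} (I : Fin m) : Formula m 0 := all (ex (♯1 ≼ ♯0 ⋏ ♯0 ε I))

/-- `C(i, j) = C(i', j')` for all `i < j` and `i' < j'` in `I`. The variables `0, …, 5` are
`i, j, i', j'`, `C(i, j)`, `C(i', j')`. -/
def isHomogeneous {m : ℕ} (C I : Fin m) : Formula m 0 :=
  closeNum (n := 6) (♯0 ε I ⋏ ♯1 ε I ⋏ lt ♯0 ♯1 ⋏ ♯2 ε I ⋏ ♯3 ε I ⋏ lt ♯2 ♯3 ⋏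
    hasColour C ♯0 ♯1 ♯4 ⋏ hasColour C ♯2 ♯3 ♯5 ⟹ ♯4 ≐ ♯5)

/-- Ordered Ramsey's Theorem for pairs. In the hypotheses the set variables `0, 1, 2` are `P`, `R`
(the order on `P`), `C`; the conclusion has the additional variable `I`, of index `0`. -/
def orderedRamsey : Sentence :=
  closeSet (m := 3)
    (isFinite 0 ⋏ isPartialOrder 0 1 ⋏ isColouring 0 2 ⋏ isOrdered 1 2 ⟹
      exSet (isInfinite 0 ⋏ isHomogeneous 3 0))

/-! ### Semantics -/

/-- An `L₂`-structure: a number sort with its operations, and a nonempty family of subsets of it as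
the set sort. Membership and equality of numbers are the true ones. -/
structure L2Structure where
  /-- The number sort. -/
  Num : Type u
  zero : Num
  one : Num
  add : Num → Num → Num
  mul : Num → Num → Num
  le : Num → Num → Prop
  /-- The range of the set variables. -/
  sets : Set (Set Num)
  sets_nonempty : sets.Nonempty

/-- The value of a term. -/
def Term.val (M : L2Structure.{u}) {n : ℕ} (e : Fin n → M.Num) : Term n → M.Num
  | .var i => e i
  | .zero => M.zero
  | .one => M.one
  | .add s t => M.add (s.val M e) (t.val M e)
  | .mul s t => M.mul (s.val M e) (t.val M e)

/-- Satisfaction; set quantifiers range over `M.sets`. -/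
def Formula.Sat (M : L2Structure.{u}) : {m n : ℕ} → Formula m n →
    (Fin m → Set M.Num) → (Fin n → M.Num) → Prop
  | _, _, .eq s t, _, e => s.val M e = t.val M e
  | _, _, .le s t, _, e => M.le (s.val M e) (t.val M e)
  | _, _, .mem t X, E, e => t.val M e ∈ E X
  | _, _, .not φ, E, e => ¬ φ.Sat M E e
  | _, _, .and φ ψ, E, e => φ.Sat M E e ∧ ψ.Sat M E e
  | _, _, .or φ ψ, E, e => φ.Sat M E e ∨ ψ.Sat M E e
  | _, _, .imp φ ψ, E, e => φ.Sat M E e → ψ.Sat M E e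
  | _, _, .all φ, E, e => ∀ x : M.Num, φ.Sat M E (Matrix.vecCons x e)
  | _, _, .ex φ, E, e => ∃ x : M.Num, φ.Sat M E (Matrix.vecCons x e)
  | _, _, .allSet φ, E, e => ∀ X ∈ M.sets, φ.Sat M (Matrix.vecCons X E) e
  | _, _, .exSet φ, E, e => ∃ X ∈ M.sets, φ.Sat M (Matrix.vecCons X E) e

/-- `M ⊨ φ` for a sentence `φ`. -/
def L2Structure.Models (M : L2Structure.{u}) (φ : Sentence) : Prop := φ.Sat M ![] ![]

/-- `φ` is a logical consequence of `T`: every model of `T` is a model of `φ`. -/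
def Entails (T : Set Sentence) (φ : Sentence) : Prop :=
  ∀ M : L2Structure.{u}, (∀ ψ ∈ T, M.Models ψ) → M.Models φ

end SecondOrderArithmetic

/-!
Work in a model `M` of `RCA₀` and of Ordered Ramsey's Theorem. A `Σ⁰₂` formula `∃ v̄ ∀ ū θ(x)` has
the `Δ⁰₀` approximations `T i j x`, saying that some `v̄ ≤ i` satisfies `θ(x)` for all `ū ≤ j`. They
are monotone in `i` and antitone in `j`; by `Σ⁰₁` collection, `∃ i ∀ j T i j x` is equivalent to the
formula. To prove it for `x = a` by induction, colour `{i < j}` by the greatest `x ≤ a` with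
`x = 0 ∨ T i j x`. This colour does not increase with `j`, so it has a constant value `p` on all
pairs of an unbounded set `I`. Fixing `i ∈ I` and letting `j ∈ I` grow shows that the formula holds
at `p`. If `p < a`, it also holds at `p + 1`, and taking `i ∈ I` large contradicts the choice of `p`
as the greatest value; hence `p = a`.
-/

namespace SecondOrderArithmetic

open Formula
open Matrix (vecCons)

/-! ### Satisfaction, substitution and universal closures -/

theorem Term.val_subst (M : L2Structure.{u}) {n n' : ℕ} (σ : Fin n → Term n') (e : Fin n' → M.Num)
    (t : Term n) : (t.subst σ).val M e = t.val M fun i => (σ i).val M e := by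
  induction t with
  | var i => rfl
  | zero => rfl
  | one => rfl
  | add s t hs ht => simp only [Term.subst, Term.val, hs, ht]
  | mul s t hs ht => simp only [Term.subst, Term.val, hs, ht]

theorem Term.val_lift (M : L2Structure.{u}) {n : ℕ} (t : Term n) (x : M.Num) (e : Fin n → M.Num) :
    t.lift.val M (vecCons x e) = t.val M e := by
  simp only [Term.lift, Term.val_subst, Term.val, Matrix.cons_val_succ]

theorem Term.val_vecCons_lift (M : L2Structure.{u}) {n n' : ℕ} (σ : Fin n → Term n') (x : M.Num)
    (e : Fin n' → M.Num) :
    (fun i => (vecCons (.var 0) (fun i => (σ i).lift) i : Term (n' + 1)).val M (vecCons x e)) =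
      vecCons x fun i => (σ i).val M e :=
  funext <| Fin.cases rfl fun i => (σ i).val_lift M x e

theorem Term.lift_subst {n n' : ℕ} (σ : Fin n → Term n') (t : Term n) :
    t.lift.subst (vecCons (.var 0) fun i => (σ i).lift) = (t.subst σ).lift := by
  induction t with
  | var i => rfl
  | zero => rfl
  | one => rfl
  | add s t hs ht => exact congrArg₂ Term.add hs ht
  | mul s t hs ht => exact congrArg₂ Term.mul hs ht

theorem Formula.sat_subst (M : L2Structure.{u}) {m n : ℕ} (φ : Formula m n) :
    ∀ {m' n' : ℕ} (ρ : Fin m → Fin m') (σ : Fin n → Term n') (E : Fin m' → Set M.Num)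
      (e : Fin n' → M.Num),
      (φ.subst ρ σ).Sat M E e ↔ φ.Sat M (fun i => E (ρ i)) fun i => (σ i).val M e := by
  have vecCons_succ {k k' : ℕ} (ρ : Fin k → Fin k') (X : Set M.Num) (E : Fin k' → Set M.Num) :
      (fun i => vecCons X E (vecCons 0 (fun i => (ρ i).succ) i)) = vecCons X fun i => E (ρ i) :=
    funext <| Fin.cases rfl fun _ => rfl
  induction φ with
  | eq s t => intros; simp only [Formula.subst, Sat, Term.val_subst]
  | le s t => intros; simp only [Formula.subst, Sat, Term.val_subst]
  | mem t X => intros; simp only [Formula.subst, Sat, Term.val_subst]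
  | not φ h => intros; simp only [Formula.subst, Sat, h]
  | and φ ψ h h' => intros; simp only [Formula.subst, Sat, h, h']
  | or φ ψ h h' => intros; simp only [Formula.subst, Sat, h, h']
  | imp φ ψ h h' => intros; simp only [Formula.subst, Sat, h, h']
  | all φ h => intros; simp only [Formula.subst, Sat, h, Term.val_vecCons_lift]
  | ex φ h => intros; simp only [Formula.subst, Sat, h, Term.val_vecCons_lift]
  | allSet φ h => intros; simp only [Formula.subst, Sat, h, vecCons_succ]
  | exSet φ h => intros; simp only [Formula.subst, Sat, h, vecCons_succ]

theorem Formula.IsDelta0.subst {m n : ℕ} {φ : Formula m n} (hφ : IsDelta0 φ) :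
    ∀ {m' n' : ℕ} (ρ : Fin m → Fin m') (σ : Fin n → Term n'), IsDelta0 (φ.subst ρ σ) := by
  induction hφ with
  | eq s t => exact fun _ _ => .eq _ _
  | le s t => exact fun _ _ => .le _ _
  | mem t X => exact fun _ _ => .mem _ _
  | not _ h => exact fun ρ σ => .not (h ρ σ)
  | and _ _ h h' => exact fun ρ σ => .and (h ρ σ) (h' ρ σ)
  | or _ _ h h' => exact fun ρ σ => .or (h ρ σ) (h' ρ σ)
  | imp _ _ h h' => exact fun ρ σ => .imp (h ρ σ) (h' ρ σ)
  | ball t _ h =>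
    intro _ _ ρ σ
    simp only [Formula.subst, Term.lift_subst]
    exact .ball _ (h _ _)
  | bex t _ h =>
    intro _ _ ρ σ
    simp only [Formula.subst, Term.lift_subst]
    exact .bex _ (h _ _)

theorem sat_closeNum (M : L2Structure.{u}) {m n : ℕ} (φ : Formula m n) (E : Fin m → Set M.Num) :
    (closeNum φ).Sat M E ![] ↔ ∀ e, φ.Sat M E e := by
  induction n with
  | zero => exact (Unique.forall_iff (p := fun e => φ.Sat M E e)).symm
  | succ n ih =>
    exact (ih (all φ)).trans (forall_comm.trans (Fin.forall_fin_succ_pi (P := φ.Sat M E)).symm)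

theorem models_closeSet (M : L2Structure.{u}) {m : ℕ} (φ : Formula m 0) :
    M.Models (closeSet φ) ↔ ∀ E : Fin m → Set M.Num, (∀ i, E i ∈ M.sets) → φ.Sat M E ![] := by
  induction m with
  | zero =>
    refine ⟨fun h E _ => ?_, fun h => h _ fun i => i.elim0⟩
    rwa [Subsingleton.elim E ![]]
  | succ m ih =>
    refine (ih (allSet φ)).trans ⟨fun h E hE => ?_, fun h E hE X hX => h _ fun i => ?_⟩
    · rw [← Matrix.cons_head_tail E]
      exact h _ (fun i => hE i.succ) _ (hE 0)
    · exact Fin.cases hX hE i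

theorem models_close (M : L2Structure.{u}) {m n : ℕ} (φ : Formula m n) :
    M.Models (close φ) ↔
      ∀ E : Fin m → Set M.Num, (∀ i, E i ∈ M.sets) → ∀ e, φ.Sat M E e := by
  simp only [close, models_closeSet, sat_closeNum]

theorem models_inductionAxiom (M : L2Structure.{u}) {m n : ℕ} (φ : Formula m (n + 1)) :
    M.Models (inductionAxiom φ) ↔
      ∀ E : Fin m → Set M.Num, (∀ i, E i ∈ M.sets) → ∀ e : Fin n → M.Num,
        φ.Sat M E (vecCons M.zero e) →
        (∀ x, φ.Sat M E (vecCons x e) → φ.Sat M E (vecCons (M.add x M.one) e)) →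
        ∀ x, φ.Sat M E (vecCons x e) := by
  have val_zero (e : Fin n → M.Num) :
      (fun i => (vecCons 0 Term.var i : Term n).val M e) = vecCons M.zero e :=
    funext <| Fin.cases rfl fun _ => rfl
  have val_succ (x : M.Num) (e : Fin n → M.Num) :
      (fun i => (vecCons (.var 0 + 1) (fun i => .var i.succ) i : Term (n + 1)).val M
        (vecCons x e)) = vecCons (M.add x M.one) e :=
    funext <| Fin.cases rfl fun _ => rfl
  simp only [inductionAxiom, models_close, Sat, Formula.sat_subst, val_zero, val_succ, and_imp, id]

theorem models_deltaComprehensionAxiom (M : L2Structure.{u}) {m n : ℕ}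
    (φ ψ : Formula m (n + 1)) :
    M.Models (deltaComprehensionAxiom φ ψ) ↔
      ∀ E : Fin m → Set M.Num, (∀ i, E i ∈ M.sets) → ∀ e : Fin n → M.Num,
        (∀ x, φ.Sat M E (vecCons x e) ↔ ¬ ψ.Sat M E (vecCons x e)) →
        ∃ X ∈ M.sets, ∀ x, x ∈ X ↔ φ.Sat M E (vecCons x e) := by
  simp only [deltaComprehensionAxiom, models_close, Sat, Formula.sat_subst, Formula.iff,
    ← iff_iff_implies_and_implies]
  rfl

/-! ### The ordered semiring of numbers -/

section Arithmetic

variable (M : L2Structure.{u})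

instance : Zero M.Num := ⟨M.zero⟩

instance : One M.Num := ⟨M.one⟩

instance : Add M.Num := ⟨M.add⟩

instance : Mul M.Num := ⟨M.mul⟩

instance : LE M.Num := ⟨M.le⟩

/-- The strict order is the one expressed by `Formula.lt`. -/
instance : LT M.Num := ⟨fun a b => a ≤ b ∧ ¬ a = b⟩

/-- The numbers of `M` form the non-negative part of a discretely ordered ring. The fields
correspond to the sentences of `basicAxioms`. -/
class DiscretelyOrdered : Prop where
  add_assoc (a b c : M.Num) : a + b + c = a + (b + c)
  add_comm (a b : M.Num) : a + b = b + a
  add_zero (a : M.Num) : a + 0 = a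
  mul_assoc (a b c : M.Num) : a * b * c = a * (b * c)
  mul_comm (a b : M.Num) : a * b = b * a
  mul_one (a : M.Num) : a * 1 = a
  mul_zero (a : M.Num) : a * 0 = 0
  mul_add (a b c : M.Num) : a * (b + c) = a * b + a * c
  le_refl (a : M.Num) : a ≤ a
  le_antisymm (a b : M.Num) : a ≤ b → b ≤ a → a = b
  le_trans (a b c : M.Num) : a ≤ b → b ≤ c → a ≤ c
  le_total (a b : M.Num) : a ≤ b ∨ b ≤ a
  add_lt_add_right (a b c : M.Num) : a < b → a + c < b + c
  mul_lt_mul_right (a b c : M.Num) : 0 < c → a < b → a * c < b * c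
  exists_add_of_le (a b : M.Num) : a ≤ b → ∃ c, a + c = b
  zero_le (a : M.Num) : 0 ≤ a
  zero_lt_one : (0 : M.Num) < 1
  one_le_of_pos (a : M.Num) : 0 < a → 1 ≤ a

variable {M} in
theorem DiscretelyOrdered.of_models (h : ∀ ψ ∈ basicAxioms, M.Models ψ) :
    DiscretelyOrdered M := by
  simp only [basicAxioms, Set.mem_insert_iff, Set.mem_singleton_iff, forall_eq_or_imp, forall_eq,
    models_close] at h
  have sat {n : ℕ} {φ : Formula 0 n}
      (hφ : ∀ E : Fin 0 → Set M.Num, (∀ i, E i ∈ M.sets) → ∀ e, φ.Sat M E e) (e : Fin n → M.Num) :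
      φ.Sat M ![] e := hφ _ (fun i => i.elim0) e
  obtain ⟨add_assoc, add_comm, add_zero, mul_assoc, mul_comm, mul_one, mul_zero, mul_add, le_refl,
    le_antisymm, le_trans, le_total, add_lt_add_right, mul_lt_mul_right, exists_add_of_le, zero_le,
    zero_lt_one, one_le_of_pos⟩ := h
  exact
    { add_assoc a b c := sat add_assoc ![a, b, c]
      add_comm a b := sat add_comm ![a, b]
      add_zero a := sat add_zero ![a]
      mul_assoc a b c := sat mul_assoc ![a, b, c]
      mul_comm a b := sat mul_comm ![a, b]
      mul_one a := sat mul_one ![a]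
      mul_zero a := sat mul_zero ![a]
      mul_add a b c := sat mul_add ![a, b, c]
      le_refl a := sat le_refl ![a]
      le_antisymm a b hab hba := sat le_antisymm ![a, b] ⟨hab, hba⟩
      le_trans a b c hab hbc := sat le_trans ![a, b, c] ⟨hab, hbc⟩
      le_total a b := sat le_total ![a, b]
      add_lt_add_right a b c hab := sat add_lt_add_right ![a, b, c] hab
      mul_lt_mul_right a b c hc hab := sat mul_lt_mul_right ![a, b, c] ⟨hc, hab⟩
      exists_add_of_le a b hab := sat exists_add_of_le ![a, b] hab
      zero_le a := sat zero_le ![a]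
      zero_lt_one := sat zero_lt_one ![]
      one_le_of_pos a ha := sat one_le_of_pos ![a] ha }

variable [DiscretelyOrdered M]

instance : CommSemiring M.Num where
  nsmul := nsmulRec
  npow := npowRec
  add_assoc := DiscretelyOrdered.add_assoc
  add_comm := DiscretelyOrdered.add_comm
  zero_add a := (DiscretelyOrdered.add_comm 0 a).trans (DiscretelyOrdered.add_zero a)
  add_zero := DiscretelyOrdered.add_zero
  mul_assoc := DiscretelyOrdered.mul_assoc
  mul_comm := DiscretelyOrdered.mul_comm
  one_mul a := (DiscretelyOrdered.mul_comm 1 a).trans (DiscretelyOrdered.mul_one a)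
  mul_one := DiscretelyOrdered.mul_one
  zero_mul a := (DiscretelyOrdered.mul_comm 0 a).trans (DiscretelyOrdered.mul_zero a)
  mul_zero := DiscretelyOrdered.mul_zero
  left_distrib := DiscretelyOrdered.mul_add
  right_distrib a b c := by
    simp only [DiscretelyOrdered.mul_comm _ c, DiscretelyOrdered.mul_add]

noncomputable instance : LinearOrder M.Num where
  le_refl := DiscretelyOrdered.le_refl
  le_trans := DiscretelyOrdered.le_trans
  le_antisymm := DiscretelyOrdered.le_antisymm
  le_total := DiscretelyOrdered.le_total
  lt_iff_le_not_ge a b := and_congr_right fun hab => not_congr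
    ⟨fun h => h ▸ DiscretelyOrdered.le_refl a, DiscretelyOrdered.le_antisymm a b hab⟩
  toDecidableLE := Classical.decRel _

instance : IsOrderedCancelAddMonoid M.Num :=
  .of_add_lt_add_left fun a b c h => by
    simpa only [add_comm a] using DiscretelyOrdered.add_lt_add_right b c a h

instance : IsStrictOrderedRing M.Num where
  zero_le_one := DiscretelyOrdered.zero_le 1
  exists_pair_ne := ⟨0, 1, DiscretelyOrdered.zero_lt_one.ne⟩
  mul_lt_mul_of_pos_left c hc a b hab := by
    simpa only [mul_comm c] using DiscretelyOrdered.mul_lt_mul_right a b c hc hab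
  mul_lt_mul_of_pos_right c hc a b hab := DiscretelyOrdered.mul_lt_mul_right a b c hc hab

instance : CanonicallyOrderedAdd M.Num where
  exists_add_of_le h := (DiscretelyOrdered.exists_add_of_le _ _ h).imp fun _ => Eq.symm
  le_add_self _ b := le_add_of_nonneg_left (DiscretelyOrdered.zero_le b)
  le_self_add _ b := le_add_of_nonneg_right (DiscretelyOrdered.zero_le b)

noncomputable instance : SuccAddOrder M.Num where
  succ a := a + 1
  succ_eq_add_one _ := rfl
  __ := SuccOrder.ofSuccLeIff (fun a => a + 1) fun {a b} => by
    refine ⟨(lt_add_one a).trans_le, fun hab => ?_⟩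
    obtain ⟨c, rfl⟩ := exists_add_of_le hab.le
    have hc : 0 < c := by simpa using hab
    exact add_le_add_right (DiscretelyOrdered.one_le_of_pos c hc) a

end Arithmetic

/-! ### The pairing function -/

section Pairing

variable {N : Type*} [CommSemiring N]

/-- The pairing `⟨a, b⟩ = (a + b)² + a`, the value of `Term.pair`. -/
def numPair (a b : N) : N := (a + b) * (a + b) + a

variable [LinearOrder N] [CanonicallyOrderedAdd N]

theorem left_le_numPair (a b : N) : a ≤ numPair a b := le_add_self

variable [IsStrictOrderedRing N] [SuccAddOrder N]

theorem right_le_numPair (a b : N) : b ≤ numPair a b := by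
  rcases eq_zero_or_pos b with rfl | hb
  · exact zero_le
  · have one_le : 1 ≤ a + b := Order.one_le_iff_pos.2 (hb.trans_le le_add_self)
    calc b ≤ a + b := le_add_self
      _ ≤ (a + b) * (a + b) := le_mul_of_one_le_left' one_le
      _ ≤ numPair a b := le_self_add

theorem numPair_lt_of_add_lt {a b a' b' : N} (h : a + b < a' + b') :
    numPair a b < numPair a' b' := by
  have h : a + b + 1 ≤ a' + b' := Order.add_one_le_iff.2 h
  have lt : a < a + b + (a + b + 1) :=
    (Order.lt_add_one_iff.2 le_self_add).trans_le le_add_self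
  calc numPair a b = (a + b) * (a + b) + a := rfl
    _ < (a + b) * (a + b) + (a + b + (a + b + 1)) := by gcongr
    _ = (a + b + 1) * (a + b + 1) := by ring
    _ ≤ (a' + b') * (a' + b') := by gcongr
    _ ≤ numPair a' b' := le_self_add

theorem numPair_inj {a b a' b' : N} : numPair a b = numPair a' b' ↔ a = a' ∧ b = b' := by
  refine ⟨fun h => ?_, fun h => by rw [h.1, h.2]⟩
  have sum_eq : a + b = a' + b' := by
    rcases lt_trichotomy (a + b) (a' + b') with hlt | heq | hgt
    · exact absurd h (numPair_lt_of_add_lt hlt).ne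
    · exact heq
    · exact absurd h (numPair_lt_of_add_lt hgt).ne'
  have left_eq : a = a' := by
    rw [numPair, numPair, sum_eq] at h
    exact add_left_cancel h
  subst left_eq
  exact ⟨rfl, add_left_cancel sum_eq⟩

end Pairing

theorem Term.val_pair (M : L2Structure.{u}) [DiscretelyOrdered M] {n : ℕ} (s t : Term n)
    (e : Fin n → M.Num) : (Term.pair s t).val M e = numPair (s.val M e) (t.val M e) := rfl

/-! ### Relations definable by `Δ⁰₀` formulas with parameters -/

section Definability

/-- The tuple whose `i`-th entry is the variable or the parameter `σ i`, where `w` lists the values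
of the variables. -/
def valuation {N : Type*} {k n : ℕ} (σ : Fin k → Fin n ⊕ N) (w : Fin n → N) (i : Fin k) : N :=
  (σ i).elim w id

variable {M : L2Structure.{u}} {n : ℕ}

/-- `R` is defined in `M` by a `Δ⁰₀` formula with number and set parameters from `M`. The formula
has its own number variables, which `σ` interprets as arguments of `R` or as parameters. -/
def Delta0Def (R : (Fin n → M.Num) → Prop) : Prop :=
  ∃ (m k : ℕ) (E : Fin m → Set M.Num) (φ : Formula m k) (σ : Fin k → Fin n ⊕ M.Num),
    (∀ i, E i ∈ M.sets) ∧ IsDelta0 φ ∧ ∀ w, φ.Sat M E (valuation σ w) ↔ R w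

theorem valuation_vecCons {N : Type*} {k n : ℕ} (s : Fin n ⊕ N) (σ : Fin k → Fin n ⊕ N)
    (w : Fin n → N) : valuation (vecCons s σ) w = vecCons (s.elim w id) (valuation σ w) :=
  funext <| Fin.cases rfl fun _ => rfl

theorem valuation_bind {N : Type*} {k l n : ℕ} (σ : Fin k → Fin l ⊕ N) (ρ : Fin l → Fin n ⊕ N)
    (w : Fin n → N) :
    valuation (fun i => (σ i).elim ρ .inr) w = valuation σ (valuation ρ w) := by
  funext i
  rcases h : σ i <;> simp only [valuation, h, Sum.elim_inl, Sum.elim_inr]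

theorem exists_valuation_vecCons {N : Type*} [Zero N] {k : ℕ} (σ : Fin k → Fin (n + 1) ⊕ N) :
    ∃ (σ' : Fin k → Fin n ⊕ N) (ν : Fin k → Fin (k + 1)), ∀ x w i,
      (vecCons x (valuation σ' w) : Fin (k + 1) → N) (ν i) = valuation σ (vecCons x w) i := by
  -- A position of `σ` holding the new variable is redirected to index `0`, so that the parameter
  -- `0` given to it by `σ'` is never read.
  refine ⟨fun i => (σ i).elim (Fin.cases (.inr 0) .inl) .inr,
    fun i => (σ i).elim (Fin.cases 0 fun _ => i.succ) fun _ => i.succ, fun x w i => ?_⟩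
  rcases h : σ i with j | a
  · cases j using Fin.cases <;> simp [valuation, h]
  · simp [valuation, h]

namespace Delta0Def

variable {R S : (Fin n → M.Num) → Prop}

theorem congr (hR : Delta0Def R) (h : ∀ w, R w ↔ S w) : Delta0Def S := by
  rwa [← funext fun w => propext (h w)]

theorem of_isDelta0 {m k : ℕ} {φ : Formula m k} (hφ : IsDelta0 φ) {E : Fin m → Set M.Num}
    (hE : ∀ i, E i ∈ M.sets) (σ : Fin k → Fin n ⊕ M.Num) :
    Delta0Def fun w => φ.Sat M E (valuation σ w) :=
  ⟨m, k, E, φ, σ, hE, hφ, fun _ => Iff.rfl⟩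

theorem comp (hR : Delta0Def R) {n' : ℕ} (ρ : Fin n → Fin n' ⊕ M.Num) :
    Delta0Def fun w => R (valuation ρ w) := by
  obtain ⟨m, k, E, φ, σ, hE, hφ, h⟩ := hR
  refine ⟨m, k, E, φ, fun i => (σ i).elim ρ .inr, hE, hφ, fun w => ?_⟩
  rw [valuation_bind]
  exact h _

theorem not (hR : Delta0Def R) : Delta0Def fun w => ¬ R w := by
  obtain ⟨m, k, E, φ, σ, hE, hφ, h⟩ := hR
  exact ⟨m, k, E, .not φ, σ, hE, .not hφ, fun w => not_congr (h w)⟩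

theorem and (hR : Delta0Def R) (hS : Delta0Def S) : Delta0Def fun w => R w ∧ S w := by
  obtain ⟨m, k, E, φ, σ, hE, hφ, hR⟩ := hR
  obtain ⟨m', k', E', φ', σ', hE', hφ', hS⟩ := hS
  refine ⟨m + m', k + k', Fin.append E E',
    .and (φ.subst (Fin.castAdd m') fun i => .var (i.castAdd k'))
      (φ'.subst (Fin.natAdd m) fun i => .var (i.natAdd k)),
    Fin.append σ σ', Fin.addCases (by simpa using hE) (by simpa using hE'),
    .and (hφ.subst _ _) (hφ'.subst _ _), fun w => and_congr ?_ ?_⟩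
  · simp only [Formula.sat_subst, Term.val, valuation, Fin.append_left]
    exact hR w
  · simp only [Formula.sat_subst, Term.val, valuation, Fin.append_right]
    exact hS w

theorem or (hR : Delta0Def R) (hS : Delta0Def S) : Delta0Def fun w => R w ∨ S w :=
  (hR.not.and hS.not).not.congr fun _ => or_iff_not_and_not.symm

theorem imp (hR : Delta0Def R) (hS : Delta0Def S) : Delta0Def fun w => R w → S w :=
  (hR.not.or hS).congr fun _ => imp_iff_not_or.symm

theorem eq {k : ℕ} (s t : Term k) (σ : Fin k → Fin n ⊕ M.Num) :
    Delta0Def fun w => s.val M (valuation σ w) = t.val M (valuation σ w) :=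
  of_isDelta0 (.eq s t) (E := ![]) (fun i => i.elim0) σ

theorem le (s t : Fin n ⊕ M.Num) : Delta0Def fun w => s.elim w id ≤ t.elim w id :=
  (of_isDelta0 (.le (.var 0) (.var 1)) (E := ![]) (fun i => i.elim0) ![s, t]).congr fun _ => Iff.rfl

theorem lt [DiscretelyOrdered M] (s t : Fin n ⊕ M.Num) :
    Delta0Def fun w => s.elim w id < t.elim w id :=
  (le t s).not.congr fun _ => not_le

theorem bex (b : Fin n ⊕ M.Num) {R : M.Num → (Fin n → M.Num) → Prop}
    (hR : Delta0Def fun w : Fin (n + 1) → M.Num => R (w 0) fun i => w i.succ) :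
    Delta0Def fun w => ∃ x ≤ b.elim w id, R x w := by
  obtain ⟨m, k, E, φ, σ, hE, hφ, h⟩ := hR
  obtain ⟨σ', ν, hν⟩ := exists_valuation_vecCons σ
  have skip_bound (x : M.Num) (w : Fin n → M.Num) (i : Fin (k + 1)) :
      vecCons x (valuation (vecCons b σ') w) (Fin.succAbove 1 i) =
        vecCons x (valuation σ' w) i := by
    cases i using Fin.cases <;> rfl
  refine ⟨m, k + 1, E, .ex (.and (.le (.var 0) (Term.lift (.var 0)))
    (φ.subst id fun i => .var (Fin.succAbove 1 (ν i)))), vecCons b σ', hE,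
    .bex _ (hφ.subst _ _), fun w => exists_congr fun x => and_congr Iff.rfl ?_⟩
  rw [Formula.sat_subst]
  simp only [Term.val, skip_bound, hν]
  exact h _

theorem ball (b : Fin n ⊕ M.Num) {R : M.Num → (Fin n → M.Num) → Prop}
    (hR : Delta0Def fun w : Fin (n + 1) → M.Num => R (w 0) fun i => w i.succ) :
    Delta0Def fun w => ∀ x ≤ b.elim w id, R x w :=
  (bex b (R := fun x w => ¬ R x w) hR.not).not.congr fun _ => by push Not; rfl

end Delta0Def

end Definability

/-! ### Bounded extensions of environments -/

section Blocks

variable {N : Type*} [Preorder N] {n : ℕ}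

/-- The environments obtained from `e` by adding `k` new number variables with values at most `b`;
they make the quantifiers of `exBlock` and `allBlock` bounded. -/
def blockExt (b : N) (e : Fin n → N) : (k : ℕ) → Set (Fin (n + k) → N)
  | 0 => {e}
  | k + 1 => {v | v 0 ≤ b ∧ Matrix.vecTail v ∈ blockExt b e k}

theorem exists_mem_blockExt_succ {b : N} {e : Fin n → N} {k : ℕ}
    {P : (Fin (n + (k + 1)) → N) → Prop} :
    (∃ v ∈ blockExt b e (k + 1), P v) ↔ ∃ v ∈ blockExt b e k, ∃ x ≤ b, P (vecCons x v) := by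
  constructor
  · rintro ⟨v, ⟨hx, hv⟩, hP⟩
    exact ⟨Matrix.vecTail v, hv, v 0, hx, (Matrix.cons_head_tail v).symm ▸ hP⟩
  · rintro ⟨v, hv, x, hx, hP⟩
    exact ⟨vecCons x v, ⟨hx, hv⟩, hP⟩

theorem forall_mem_blockExt_succ {b : N} {e : Fin n → N} {k : ℕ}
    {P : (Fin (n + (k + 1)) → N) → Prop} :
    (∀ v ∈ blockExt b e (k + 1), P v) ↔ ∀ v ∈ blockExt b e k, ∀ x ≤ b, P (vecCons x v) := by
  simpa using (exists_mem_blockExt_succ (b := b) (e := e) (P := fun v => ¬ P v)).not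

theorem blockExt_mono {b b' : N} (h : b ≤ b') (e : Fin n → N) (k : ℕ) :
    blockExt b e k ⊆ blockExt b' e k := by
  induction k with
  | zero => exact subset_rfl
  | succ k ih => exact fun v hv => ⟨hv.1.trans h, ih hv.2⟩

end Blocks

section Blocks

variable {M : L2Structure.{u}} {m n : ℕ}

theorem Delta0Def.bex_vecCons {R : M.Num → M.Num → (Fin (n + 1) → M.Num) → Prop}
    (hR : Delta0Def fun w : Fin (n + 1 + 2) → M.Num => R (w 0) (w 1) fun i => w i.succ.succ) :
    Delta0Def fun w : Fin (n + 2) → M.Num =>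
      ∃ x ≤ w 0, R (w 0) (w 1) (vecCons x fun i => w i.succ.succ) := by
  refine bex (.inl 0) ((hR.comp <| vecCons (.inl 1) <| vecCons (.inl 2) <| vecCons (.inl 0)
    fun i => .inl i.succ.succ.succ).congr fun w => ?_)
  simp only [valuation_vecCons, Matrix.cons_val_zero, Matrix.cons_val_one, Matrix.cons_val_succ]
  rfl

variable [DiscretelyOrdered M]

theorem sat_exBlock {k : ℕ} (φ : Formula m (n + k)) (E : Fin m → Set M.Num) (e : Fin n → M.Num) :
    (exBlock k φ).Sat M E e ↔ ∃ b, ∃ v ∈ blockExt b e k, φ.Sat M E v := by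
  induction k with
  | zero => simp [exBlock, blockExt]
  | succ k ih =>
    simp only [exists_mem_blockExt_succ]
    refine (ih (ex φ)).trans ⟨?_, ?_⟩
    · rintro ⟨b, v, hv, x, hx⟩
      exact ⟨max b x, v, blockExt_mono (le_max_left b x) e k hv, x, le_max_right b x, hx⟩
    · rintro ⟨b, v, hv, x, -, hx⟩
      exact ⟨b, v, hv, x, hx⟩

theorem sat_allBlock {k : ℕ} (φ : Formula m (n + k)) (E : Fin m → Set M.Num) (e : Fin n → M.Num) :
    (allBlock k φ).Sat M E e ↔ ∀ b, ∀ v ∈ blockExt b e k, φ.Sat M E v := by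
  induction k with
  | zero => simp [allBlock, blockExt]
  | succ k ih =>
    simp only [forall_mem_blockExt_succ]
    refine (ih (all φ)).trans ⟨fun h b v hv x _ => h b v hv x, fun h b v hv x => ?_⟩
    exact h (max b x) v (blockExt_mono (le_max_left b x) e k hv) x (le_max_right b x)

namespace Delta0Def

theorem exists_mem_blockExt {k : ℕ} {R : M.Num → M.Num → (Fin (n + k) → M.Num) → Prop}
    (hR : Delta0Def fun w : Fin (n + k + 2) → M.Num => R (w 0) (w 1) fun i => w i.succ.succ) :
    Delta0Def fun w : Fin (n + 2) → M.Num =>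
      ∃ v ∈ blockExt (w 0) (fun i => w i.succ.succ) k, R (w 0) (w 1) v := by
  induction k with
  | zero =>
    refine hR.congr fun w => ?_
    simp only [blockExt, Set.mem_singleton_iff, exists_eq_left]
    rfl
  | succ k ih =>
    simp only [exists_mem_blockExt_succ]
    exact ih (R := fun i j v => ∃ x ≤ i, R i j (vecCons x v)) (bex_vecCons hR)

theorem forall_mem_blockExt {k : ℕ} {R : M.Num → M.Num → (Fin (n + k) → M.Num) → Prop}
    (hR : Delta0Def fun w : Fin (n + k + 2) → M.Num => R (w 0) (w 1) fun i => w i.succ.succ) :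
    Delta0Def fun w : Fin (n + 2) → M.Num =>
      ∀ v ∈ blockExt (w 0) (fun i => w i.succ.succ) k, R (w 0) (w 1) v :=
  (exists_mem_blockExt (R := fun i j v => ¬ R i j v) hR.not).not.congr fun _ => by push Not; rfl

end Delta0Def

end Blocks

/-! ### Consequences of `RCA₀` -/

/-- `M` is a model of `RCA₀`. -/
class RCA0Model (M : L2Structure.{u}) : Prop where
  models : ∀ ψ ∈ RCA0, M.Models ψ

section RCA0

variable {M : L2Structure.{u}} [RCA0Model M]

instance : DiscretelyOrdered M := .of_models fun ψ hψ => RCA0Model.models ψ (.inl (.inl hψ))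

theorem sigma1_induction {R : M.Num → M.Num → Prop}
    (hR : Delta0Def fun w : Fin 2 → M.Num => R (w 0) (w 1)) (zero : ∃ z, R z 0)
    (succ : ∀ x, (∃ z, R z x) → ∃ z, R z (x + 1)) (x : M.Num) : ∃ z, R z x := by
  obtain ⟨m, k, E, φ, σ, hE, hφ, h⟩ := hR
  obtain ⟨σ₁, ν₁, h₁⟩ := exists_valuation_vecCons σ
  obtain ⟨σ₂, ν₂, h₂⟩ := exists_valuation_vecCons σ₁
  let ψ : Formula m (k + 1) := φ.subst id fun i => .var (ν₁ i)
  let χ : Formula m (k + 1) := (ex ψ).subst id fun i => .var (ν₂ i)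
  have sat_χ (x : M.Num) : χ.Sat M E (vecCons x (valuation σ₂ ![])) ↔ ∃ z, R z x := by
    simp only [χ, ψ, Formula.sat_subst, Sat, Term.val, h₁, h₂]
    exact exists_congr fun z => h ![z, x]
  have induction_χ : M.Models (inductionAxiom χ) :=
    RCA0Model.models _ (.inr ⟨m, k, χ, ⟨1, _, (hφ.subst _ _).subst _ _, rfl⟩, rfl⟩)
  have := (models_inductionAxiom M χ).1 induction_χ E hE (valuation σ₂ ![])
  simp only [sat_χ] at this
  exact this zero succ x

theorem delta0_induction {R : M.Num → Prop} (hR : Delta0Def fun w : Fin 1 → M.Num => R (w 0))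
    (zero : R 0) (succ : ∀ x, R x → R (x + 1)) (x : M.Num) : R x :=
  (sigma1_induction (R := fun _ x => R x) (hR.comp ![.inl 1]) ⟨0, zero⟩
    (fun x ⟨z, h⟩ => ⟨z, succ x h⟩) x).elim fun _ h => h

theorem delta0_comprehension {R : M.Num → Prop}
    (hR : Delta0Def fun w : Fin 1 → M.Num => R (w 0)) : {x | R x} ∈ M.sets := by
  obtain ⟨m, k, E, φ, σ, hE, hφ, h⟩ := hR
  obtain ⟨σ', ν, hν⟩ := exists_valuation_vecCons σ
  let χ : Formula m (k + 1) := φ.subst id fun i => .var (ν i)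
  have hχ : IsDelta0 χ := hφ.subst _ _
  have sat_χ (x : M.Num) : χ.Sat M E (vecCons x (valuation σ' ![])) ↔ R x := by
    simp only [χ, Formula.sat_subst, Term.val, hν]
    exact h ![x]
  have comprehension_χ : M.Models (deltaComprehensionAxiom χ χ.not) :=
    RCA0Model.models _ (.inl (.inr ⟨m, k, χ, χ.not, ⟨0, χ, hχ, rfl⟩, ⟨0, _, hχ.not, rfl⟩, rfl⟩))
  obtain ⟨X, hX, mem_X⟩ := (models_deltaComprehensionAxiom M _ _).1 comprehension_χ E hE
    (valuation σ' ![]) fun x => not_not.symm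
  rwa [show {x | R x} = X from Set.ext fun x => ((mem_X x).trans (sat_χ x)).symm]

theorem sigma1_collection {R : M.Num → M.Num → Prop}
    (hR : Delta0Def fun w : Fin 2 → M.Num => R (w 0) (w 1)) {b : M.Num}
    (h : ∀ x ≤ b, ∃ z, R z x) : ∃ z, ∀ x ≤ b, ∃ y ≤ z, R y x := by
  suffices ∀ u, ∃ z, ∀ x ≤ u, x ≤ b → ∃ y ≤ z, R y x from
    (this b).imp fun z hz x hx => hz x hx hx
  refine sigma1_induction (R := fun z u => ∀ x ≤ u, x ≤ b → ∃ y ≤ z, R y x) ?_ ?_ ?_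
  · exact .ball (.inl 1) (.imp (.le (.inl 0) (.inr b)) (.bex (.inl 1) (hR.comp ![.inl 0, .inl 1])))
  · obtain ⟨z, hz⟩ := h 0 zero_le
    exact ⟨z, fun x hx _ => ⟨z, le_rfl, nonpos_iff_eq_zero.1 hx ▸ hz⟩⟩
  · rintro u ⟨z, hz⟩
    obtain ⟨z', hz'⟩ : ∃ z', u + 1 ≤ b → R z' (u + 1) := by
      by_cases hu : u + 1 ≤ b
      · exact (h _ hu).imp fun z' hz' _ => hz'
      · exact ⟨0, fun hu' => absurd hu' hu⟩
    refine ⟨max z z', fun x hx hxb => ?_⟩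
    rcases hx.lt_or_eq with hx | rfl
    · obtain ⟨y, hy, hRy⟩ := hz x (Order.lt_add_one_iff.1 hx) hxb
      exact ⟨y, hy.trans (le_max_left z z'), hRy⟩
    · exact ⟨z', le_max_right z z', hz' hxb⟩

theorem exists_le_forall_of_antitone {R : M.Num → M.Num → Prop}
    (hR : Delta0Def fun w : Fin 2 → M.Num => R (w 0) (w 1)) (anti : ∀ x, Antitone (R · x))
    {b : M.Num} (h : ∀ j, ∃ x ≤ b, R j x) : ∃ x ≤ b, ∀ j, R j x := by
  by_contra! hcon
  obtain ⟨z, hz⟩ := sigma1_collection (R := fun j x => ¬ R j x) hR.not hcon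
  obtain ⟨x, hx, hRx⟩ := h z
  obtain ⟨y, hy, hRy⟩ := hz x hx
  exact hRy (anti x hy hRx)

theorem exists_mem_blockExt_forall_of_antitone {n k : ℕ}
    {R : M.Num → M.Num → (Fin (n + k) → M.Num) → Prop}
    (hR : Delta0Def fun w : Fin (n + k + 2) → M.Num => R (w 0) (w 1) fun i => w i.succ.succ)
    (anti : ∀ i v, Antitone (R i · v)) {i : M.Num} {e : Fin n → M.Num}
    (h : ∀ j, ∃ v ∈ blockExt i e k, R i j v) : ∃ v ∈ blockExt i e k, ∀ j, R i j v := by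
  induction k with
  | zero => simpa only [blockExt, Set.mem_singleton_iff, exists_eq_left] using h
  | succ k ih =>
    simp only [exists_mem_blockExt_succ] at h ⊢
    obtain ⟨v, hv, hvx⟩ := ih (R := fun i j v => ∃ x ≤ i, R i j (vecCons x v)) hR.bex_vecCons
      (fun i v j j' hj => Exists.imp fun x => And.imp_right (anti i _ hj)) h
    refine ⟨v, hv, exists_le_forall_of_antitone ?_ (fun x => anti i (vecCons x v)) hvx⟩
    refine (hR.comp <| vecCons (.inr i) <| vecCons (.inl 0) <| vecCons (.inl 1)
      fun l => .inr (v l)).congr fun w => ?_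
    simp only [valuation_vecCons, Matrix.cons_val_zero, Matrix.cons_val_one, Matrix.cons_val_succ]
    rfl

theorem exists_isGreatest {S : M.Num → Prop} (hS : Delta0Def fun w : Fin 1 → M.Num => S (w 0))
    {a : M.Num} (h : ∃ x ≤ a, S x) : ∃ p, IsGreatest {x | x ≤ a ∧ S x} p := by
  by_contra! hcon
  have unbounded (u : M.Num) : ∃ x ≤ a, u ≤ x ∧ S x := by
    refine delta0_induction (R := fun u => ∃ x ≤ a, u ≤ x ∧ S x) ?_ ?_ ?_ u
    · exact .bex (.inr a) (.and (.le (.inl 1) (.inl 0)) (hS.comp ![.inl 0]))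
    · exact h.imp fun x hx => ⟨hx.1, zero_le, hx.2⟩
    · rintro u ⟨x, hxa, hux, hSx⟩
      obtain ⟨y, ⟨hya, hSy⟩, hxy⟩ : ∃ y, (y ≤ a ∧ S y) ∧ x < y := by
        simpa [IsGreatest, upperBounds, hxa, hSx, and_assoc] using hcon x
      exact ⟨y, hya, Order.add_one_le_iff.2 (hux.trans_lt hxy), hSy⟩
  obtain ⟨x, hxa, hax, -⟩ := unbounded (a + 1)
  exact (Order.add_one_le_iff.1 hax).not_ge hxa

end RCA0

/-! ### Ordered Ramsey's Theorem for definable colourings -/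

section Codes

variable {N : Type*} [CommSemiring N] [LinearOrder N]

/-- The codes of the pairs `x ≤ y` of elements of `{x | x ≤ a}`: the coded order of the finite
chain of colours. -/
def leCode (a : N) : Set N := {r | ∃ y ≤ a, ∃ x ≤ y, r = numPair x y}

/-- The codes of the triples `⟨⟨i, j⟩, c i j⟩` with `i < j`: the coded colouring of pairs given by
the values of `c` above the diagonal. -/
def colourCode (c : N → N → N) : Set N := {r | ∃ i j, i < j ∧ r = numPair (numPair i j) (c i j)}

variable [CanonicallyOrderedAdd N] [IsStrictOrderedRing N] [SuccAddOrder N]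

theorem numPair_mem_leCode {a x y : N} : numPair x y ∈ leCode a ↔ x ≤ y ∧ y ≤ a := by
  refine ⟨?_, fun h => ⟨y, h.2, x, h.1, rfl⟩⟩
  rintro ⟨y', hy', x', hx', h⟩
  obtain ⟨rfl, rfl⟩ := numPair_inj.1 h
  exact ⟨hx', hy'⟩

theorem numPair_mem_colourCode {c : N → N → N} {i j p : N} :
    numPair (numPair i j) p ∈ colourCode c ↔ i < j ∧ p = c i j := by
  refine ⟨?_, fun h => ⟨i, j, h.1, by rw [h.2]⟩⟩
  rintro ⟨i', j', hij, h⟩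
  obtain ⟨hpair, hp⟩ := numPair_inj.1 h
  obtain ⟨rfl, rfl⟩ := numPair_inj.1 hpair
  exact ⟨hij, hp⟩

end Codes

theorem exists_gt_of_isCofinal {α : Type*} [Preorder α] [NoMaxOrder α] {I : Set α}
    (hI : IsCofinal I) (b : α) : ∃ j ∈ I, b < j := by
  obtain ⟨c, hbc⟩ := exists_gt b
  exact (hI c).imp fun _ h => ⟨h.1, hbc.trans_le h.2⟩

section OrderedRamsey

variable {M : L2Structure.{u}} {m : ℕ}

theorem sat_lt {n : ℕ} (s t : Term n) (E : Fin m → Set M.Num) (e : Fin n → M.Num) :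
    (lt s t).Sat M E e ↔ s.val M e < t.val M e := Iff.rfl

theorem sat_isInfinite (E : Fin m → Set M.Num) (I : Fin m) :
    (isInfinite I).Sat M E ![] ↔ IsCofinal (E I) :=
  forall_congr' fun _ => exists_congr fun _ => and_comm

variable [DiscretelyOrdered M] {E : Fin m → Set M.Num} {P R C I : Fin m} {a : M.Num}
  {c : M.Num → M.Num → M.Num}

theorem sat_isPartialOrder_leCode (hP : E P = Set.Iic a) (hR : E R = leCode a) :
    (isPartialOrder P R).Sat M E ![] := by
  simp only [isPartialOrder, Sat, sat_closeNum, Term.val_pair, Term.val, hP, hR,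
    numPair_mem_leCode]
  refine ⟨?_, fun e he => ⟨le_rfl, he⟩, fun e he => le_antisymm he.1.1 he.2.1,
    fun e he => ⟨he.1.1.trans he.2.1, he.2.2⟩⟩
  rintro e ⟨y, hy, x, hx, hxy⟩
  exact ⟨y, x, hx.trans hy, hy, hxy⟩

theorem sat_isColouring_colourCode (hP : E P = Set.Iic a) (hC : E C = colourCode c)
    (hca : ∀ i j, c i j ≤ a) : (isColouring P C).Sat M E ![] := by
  simp only [isColouring, hasColour, Sat, sat_closeNum, sat_lt, Term.val_pair, Term.val, hP, hC,
    numPair_mem_colourCode]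
  refine ⟨?_, fun e he => ⟨c (e 0) (e 1), he, rfl⟩, fun e he => he.1.2.trans he.2.2.symm⟩
  rintro e ⟨i, j, hij, hc⟩
  exact ⟨c i j, j, i, hij, hca i j, hc⟩

theorem sat_isOrdered_colourCode (hR : E R = leCode a) (hC : E C = colourCode c)
    (hca : ∀ i j, c i j ≤ a) (hanti : ∀ i j k, i < j → j < k → c i k ≤ c i j) :
    (isOrdered R C).Sat M E ![] := by
  simp only [isOrdered, hasColour, Sat, sat_closeNum, sat_lt, Term.val_pair, Term.val, hR, hC,
    numPair_mem_leCode, numPair_mem_colourCode]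
  rintro e ⟨hij, hjk, ⟨-, hp⟩, -, hp'⟩
  rw [hp, hp']
  exact ⟨hanti _ _ _ hij hjk, hca _ _⟩

theorem sat_isHomogeneous_colourCode (hC : E C = colourCode c) :
    (isHomogeneous C I).Sat M E ![] ↔ ∀ i ∈ E I, ∀ j ∈ E I, i < j →
      ∀ i' ∈ E I, ∀ j' ∈ E I, i' < j' → c i j = c i' j' := by
  simp only [isHomogeneous, hasColour, Sat, sat_closeNum, sat_lt, Term.val_pair, Term.val, hC,
    numPair_mem_colourCode]
  constructor
  · exact fun h i hi j hj hij i' hi' j' hj' hij' => h ![i, j, i', j', c i j, c i' j']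
      ⟨hi, hj, hij, hi', hj', hij', ⟨hij, rfl⟩, hij', rfl⟩
  · rintro h e ⟨hi, hj, hij, hi', hj', hij', ⟨-, hp⟩, -, hp'⟩
    rw [hp, hp', h _ hi _ hj hij _ hi' _ hj' hij']

end OrderedRamsey

section OrderedRamsey

variable {M : L2Structure.{u}} [RCA0Model M]

theorem Iic_mem_sets (a : M.Num) : Set.Iic a ∈ M.sets :=
  delta0_comprehension (.le (.inl 0) (.inr a))

theorem leCode_mem_sets (a : M.Num) : leCode a ∈ M.sets :=
  delta0_comprehension <| .bex (.inr a) <| .bex (.inl 0) <|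
    .eq (.var 0) (.pair (.var 1) (.var 2)) ![.inl 2, .inl 0, .inl 1]

theorem colourCode_mem_sets {c : M.Num → M.Num → M.Num}
    (hc : Delta0Def fun w : Fin 3 → M.Num => w 2 = c (w 0) (w 1)) : colourCode c ∈ M.sets := by
  have bounded (r : M.Num) : r ∈ colourCode c ↔
      ∃ i ≤ r, ∃ j ≤ r, ∃ p ≤ r, (i < j ∧ p = c i j) ∧ r = numPair (numPair i j) p := by
    constructor
    · rintro ⟨i, j, hij, rfl⟩
      exact ⟨i, (left_le_numPair i j).trans (left_le_numPair _ _), j,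
        (right_le_numPair i j).trans (left_le_numPair _ _), c i j, right_le_numPair _ _,
        ⟨hij, rfl⟩, rfl⟩
    · rintro ⟨i, -, j, -, p, -, ⟨hij, rfl⟩, hr⟩
      exact ⟨i, j, hij, hr⟩
  rw [show colourCode c = {r | _} from Set.ext bounded]
  exact delta0_comprehension <| .bex (.inl 0) <| .bex (.inl 1) <| .bex (.inl 2) <|
    ((Delta0Def.lt (.inl 2) (.inl 1)).and (hc.comp ![.inl 2, .inl 1, .inl 0])).and <|
      .eq (.var 0) (.pair (.pair (.var 1) (.var 2)) (.var 3)) ![.inl 3, .inl 2, .inl 1, .inl 0]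

theorem exists_homogeneous (hORT : M.Models orderedRamsey) {c : M.Num → M.Num → M.Num}
    (hc : Delta0Def fun w : Fin 3 → M.Num => w 2 = c (w 0) (w 1)) {a : M.Num}
    (hca : ∀ i j, c i j ≤ a) (hanti : ∀ i j k, i < j → j < k → c i k ≤ c i j) :
    ∃ I : Set M.Num, IsCofinal I ∧ ∃ p, ∀ i ∈ I, ∀ j ∈ I, i < j → c i j = p := by
  obtain ⟨I, -, infinite, homogeneous⟩ := (models_closeSet M _).1 hORT
    ![Set.Iic a, leCode a, colourCode c]
    (Fin.cases (Iic_mem_sets a) <| Fin.cases (leCode_mem_sets a) <|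
      Fin.cases (colourCode_mem_sets hc) fun i => i.elim0)
    ⟨⟨a + 1, fun x (hx : x ≤ a) => hx.trans_lt (lt_add_one a)⟩, sat_isPartialOrder_leCode rfl rfl,
      sat_isColouring_colourCode rfl rfl hca, sat_isOrdered_colourCode rfl rfl hca hanti⟩
  have hI : IsCofinal I := (sat_isInfinite _ _).1 infinite
  obtain ⟨i₀, hi₀, -⟩ := hI 0
  obtain ⟨j₀, hj₀, hij₀⟩ := exists_gt_of_isCofinal hI i₀
  exact ⟨I, hI, c i₀ j₀, fun i hi j hj hij =>
    (sat_isHomogeneous_colourCode rfl).1 homogeneous i hi j hj hij i₀ hi₀ j₀ hj₀ hij₀⟩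

theorem exists_cofinal_isGreatest (hORT : M.Models orderedRamsey)
    {S : M.Num → M.Num → M.Num → Prop}
    (hS : Delta0Def fun w : Fin 3 → M.Num => S (w 0) (w 1) (w 2))
    (hanti : ∀ i x, Antitone (S i · x)) {a : M.Num} (hne : ∀ i j, ∃ x ≤ a, S i j x) :
    ∃ I : Set M.Num, IsCofinal I ∧
      ∃ p, ∀ i ∈ I, ∀ j ∈ I, i < j → IsGreatest {x | x ≤ a ∧ S i j x} p := by
  choose c hc using fun i j => exists_isGreatest (S := S i j)
    (hS.comp ![.inr i, .inr j, .inl 0]) (hne i j)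
  have graph : Delta0Def fun w : Fin 3 → M.Num => w 2 = c (w 0) (w 1) := by
    refine Delta0Def.congr (.and (.and (.le (.inl 2) (.inr a)) hS)
      (.ball (.inr a) (R := fun x w => S (w 0) (w 1) x → x ≤ w 2)
        (.imp (hS.comp ![.inl 1, .inl 2, .inl 0]) (.le (.inl 0) (.inl 3))))) fun w => ?_
    have isGreatest_iff : IsGreatest {x | x ≤ a ∧ S (w 0) (w 1) x} (w 2) ↔ w 2 = c (w 0) (w 1) :=
      ⟨fun h => h.unique (hc _ _), fun h => h ▸ hc _ _⟩
    exact (and_congr_right' (forall_congr' fun x => and_imp.symm)).trans isGreatest_iff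
  obtain ⟨I, hI, p, hp⟩ := exists_homogeneous hORT graph (fun i j => (hc i j).1.1)
    fun i j k _ hjk => (hc i j).2 ⟨(hc i k).1.1, hanti i _ hjk.le (hc i k).1.2⟩
  exact ⟨I, hI, p, fun i hi j hj hij => hp i hi j hj hij ▸ hc i j⟩

end OrderedRamsey

/-! ### Induction for `Σ⁰₂` formulas -/

section ApproxSat

/-- The bounded approximation to the truth of `∃ v̄ ∀ ū θ` at `e`: some `v̄ ≤ i` satisfies `θ` for
all `ū ≤ j`. -/
def approxSat (M : L2Structure.{u}) [DiscretelyOrdered M] {m n k l : ℕ} (θ : Formula m (n + k + l))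
    (E : Fin m → Set M.Num) (i j : M.Num) (e : Fin n → M.Num) : Prop :=
  ∃ v ∈ blockExt i e k, ∀ u ∈ blockExt j v l, θ.Sat M E u

variable {M : L2Structure.{u}} [DiscretelyOrdered M] {m n k l : ℕ} (θ : Formula m (n + k + l))
  (E : Fin m → Set M.Num)

theorem monotone_approxSat (j : M.Num) (e : Fin n → M.Num) :
    Monotone (approxSat M θ E · j e) :=
  fun _ _ hi ⟨v, hv, h⟩ => ⟨v, blockExt_mono hi e k hv, h⟩

theorem antitone_approxSat (i : M.Num) (e : Fin n → M.Num) :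
    Antitone (approxSat M θ E i · e) :=
  fun _ _ hj ⟨v, hv, h⟩ => ⟨v, hv, fun u hu => h u (blockExt_mono hj v l hu)⟩

variable {θ E}

theorem Delta0Def.forall_mem_blockExt_sat (hθ : IsDelta0 θ) (hE : ∀ i, E i ∈ M.sets) :
    Delta0Def fun w : Fin (n + k + 2) → M.Num =>
      ∀ u ∈ blockExt (w 1) (fun i => w i.succ.succ) l, θ.Sat M E u := by
  have bounded_first := forall_mem_blockExt (M := M) (n := n + k) (k := l)
    (R := fun _ _ u => θ.Sat M E u) (of_isDelta0 hθ hE fun i => .inl i.succ.succ)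
  refine (bounded_first.comp <| vecCons (.inl 1) <| vecCons (.inl 0)
    fun i => .inl i.succ.succ).congr fun w => ?_
  simp only [valuation_vecCons]
  rfl

theorem Delta0Def.approxSat (hθ : IsDelta0 θ) (hE : ∀ i, E i ∈ M.sets) :
    Delta0Def fun w : Fin (n + 2) → M.Num =>
      approxSat M θ E (w 0) (w 1) fun i => w i.succ.succ :=
  exists_mem_blockExt (R := fun _ j v => ∀ u ∈ blockExt j v l, θ.Sat M E u)
    (forall_mem_blockExt_sat hθ hE)

end ApproxSat

section Sigma2Induction

variable {M : L2Structure.{u}} [RCA0Model M]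

theorem exists_forall_induction (hORT : M.Models orderedRamsey) {T : M.Num → M.Num → M.Num → Prop}
    (hT : Delta0Def fun w : Fin 3 → M.Num => T (w 0) (w 1) (w 2))
    (mono : ∀ j x, Monotone (T · j x)) (anti : ∀ i x, Antitone (T i · x))
    (zero : ∃ i, ∀ j, T i j 0) (succ : ∀ x, (∃ i, ∀ j, T i j x) → ∃ i, ∀ j, T i j (x + 1))
    (a : M.Num) : ∃ i, ∀ j, T i j a := by
  obtain ⟨I, hI, p, hp⟩ := exists_cofinal_isGreatest hORT (S := fun i j x => x = 0 ∨ T i j x)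
    (.or (.eq (.var 0) .zero ![.inl 2]) hT) (fun i x j j' hj => Or.imp_right (anti i x hj))
    (a := a) fun i j => ⟨0, zero_le, .inl rfl⟩
  have holds_p : ∃ i, ∀ j, T i j p := by
    rcases eq_or_ne p 0 with rfl | hp0
    · exact zero
    obtain ⟨i, hi, -⟩ := hI 0
    refine ⟨i, fun j => ?_⟩
    obtain ⟨j', hj', hjj'⟩ := exists_gt_of_isCofinal hI (max i j)
    obtain ⟨⟨-, eq_zero_or_T⟩, -⟩ := hp i hi j' hj' ((le_max_left i j).trans_lt hjj')
    exact anti i p ((le_max_right i j).trans hjj'.le) (eq_zero_or_T.resolve_left hp0)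
  obtain ⟨i₀, hi₀⟩ := succ p holds_p
  obtain ⟨i, hi, hi₀i⟩ := hI i₀
  obtain ⟨j, hj, hij⟩ := exists_gt_of_isCofinal hI i
  obtain ⟨⟨hpa, -⟩, greatest⟩ := hp i hi j hj hij
  rcases hpa.eq_or_lt with rfl | hlt
  · exact holds_p
  · have le_p : p + 1 ≤ p := greatest ⟨Order.add_one_le_iff.2 hlt, .inr (mono j _ hi₀i (hi₀ j))⟩
    exact absurd le_p (lt_add_one p).not_ge

theorem sat_exBlock_allBlock_iff {m n k l : ℕ} {θ : Formula m (n + k + l)} (hθ : IsDelta0 θ)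
    {E : Fin m → Set M.Num} (hE : ∀ i, E i ∈ M.sets) (e : Fin n → M.Num) :
    (exBlock k (allBlock l θ)).Sat M E e ↔ ∃ i, ∀ j, approxSat M θ E i j e := by
  simp only [sat_exBlock, sat_allBlock]
  refine exists_congr fun i => ⟨fun ⟨v, hv, h⟩ j => ⟨v, hv, h j⟩, fun h => ?_⟩
  exact exists_mem_blockExt_forall_of_antitone (R := fun _ j v => ∀ u ∈ blockExt j v l, θ.Sat M E u)
    (.forall_mem_blockExt_sat hθ hE)
    (fun _ v _ _ hj h u hu => h u (blockExt_mono hj v l hu)) h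

theorem models_sigma2Induction (hORT : M.Models orderedRamsey) {m n : ℕ} {φ : Formula m (n + 1)}
    (hφ : IsSigma 2 φ) : M.Models (inductionAxiom φ) := by
  obtain ⟨k, _, ⟨l, θ, hθ, rfl⟩, rfl⟩ := hφ
  refine (models_inductionAxiom M _).2 fun E hE e => ?_
  simp only [sat_exBlock_allBlock_iff hθ hE]
  have definable := (Delta0Def.approxSat hθ hE).comp
    (vecCons (.inl 0) <| vecCons (.inl 1) <| vecCons (.inl 2) fun i => .inr (e i) :
      Fin (n + 1 + 2) → Fin 3 ⊕ M.Num)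
  simp only [valuation_vecCons] at definable
  exact exists_forall_induction hORT (T := fun i j x => approxSat M θ E i j (vecCons x e))
    definable (fun j x => monotone_approxSat θ E j _) fun i x => antitone_approxSat θ E i _

end Sigma2Induction

end SecondOrderArithmetic

theorem mainTheorem5 (φ : SecondOrderArithmetic.Sentence)
    (hφ : φ ∈ SecondOrderArithmetic.SigmaInduction 2) :
    SecondOrderArithmetic.Entails.{u}
      (SecondOrderArithmetic.RCA0 ∪ {SecondOrderArithmetic.orderedRamsey}) φ := by
  intro M models_axioms
  have : SecondOrderArithmetic.RCA0Model M := ⟨fun ψ hψ => models_axioms ψ (.inl hψ)⟩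
  have models_orderedRamsey := models_axioms _ (.inr rfl)
  obtain ⟨m, n, φ, hφ, rfl⟩ := hφ
  exact SecondOrderArithmetic.models_sigma2Induction models_orderedRamsey hφ
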